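/- Let $N\ge 2$ be an integer with prime factorization $N=\prod_{k=1}^m p_k^{r_k}$ ($p_1,\dots,p_m$ distinct primes, $r_k\ge 1$). For $S\subseteq\{1,\dots,m\}$ put $P_S=\prod_{k\in S}p_k$ (so $P_\emptyset=1$), let $P_N=\prod_{k=1}^m(p_k-1)$, and let $\mu_N=2$ if $m=1$ and $p_1\equiv 1\pmod 8$, and $\mu_N=1$ otherwise. Let $\eta(\tau)=q^{1/24}\prod_{n=1}^\infty(1-q^n)$, where $q=e^{2\pi i\tau}$ and $q^{1/24}=e^{2\pi i\tau/24}$, be the Dedekind eta-function on the complex upper half-plane $\mathbb{H}$. Then the $\eta$-quotient $$g(\tau)=\prod_{S\subseteq\{1,\dots,m\}}\eta\bigl((N/P_S)\tau\bigr)^{24(-1)^{|S|}\mu_N/\gcd(24,P_N)}\qquad(\tau\in\mathbb{H})$$ is a weakly holomorphic modular function on $\Gamma_0(N)=\left\{\begin{pmatrix}a&b\\c&d\end{pmatrix}\in\mathrm{SL}_2(\mathbb{Z}) : c\equiv 0\pmod N\right\}$ with rational Fourier coefficients. That is, $g$ is holomorphic on $\mathbb{H}$; $g(\gamma\tau)=g(\tau)$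 for all $\gamma\in\Gamma_0(N)$ and $\tau\in\mathbb{H}$; $g$ is meromorphic at all cusps, i.e. for every $\gamma\in\mathrm{SL}_2(\mathbb{Z})$ there are an integer $h\ge1$ and complex numbers $c_n$ $(n\in\mathbb{Z})$, zero for all sufficiently negative $n$, such that $g(\gamma\tau)=\sum_{n\in\mathbb{Z}} c_n e^{2\pi i n\tau/h}$ for all $\tau\in\mathbb{H}$; and the expansion of $g$ itself has the form $g(\tau)=\sum_{n\in\mathbb{Z}}a_nq^n$ with all $a_n\in\mathbb{Q}$ and $a_n=0$ for all sufficiently negative $n$. -/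

import Mathlib

open scoped MatrixGroups Manifold

noncomputable section

namespace EtaQuotient

/-- `P_S`, the product of the elements of `S` (equal to `1` if `S` is empty). -/
def primeProd (S : Finset ℕ) : ℕ := ∏ p ∈ S, p

/-- `P_N = ∏ (p - 1)`, the product being over the prime divisors `p` of `N`. -/
def totProd (N : ℕ) : ℕ := ∏ p ∈ N.primeFactors, (p - 1)

/-- `μ_N`: it is `2` if `N` has exactly one prime divisor and this prime is `1` modulo `8`,
and it is `1` otherwise. -/
def mu (N : ℕ) : ℕ :=
  if N.primeFactors.card = 1 ∧ ∀ p ∈ N.primeFactors, p ≡ 1 [MOD 8] then 2 else 1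

/-- The exponent `24 (-1)^{|S|} μ_N / gcd(24, P_N)`. The division of integers is exact, because
`gcd(24, P_N)` divides `24`. -/
def exponent (N : ℕ) (S : Finset ℕ) : ℤ :=
  24 * (-1) ^ S.card * (mu N : ℤ) / (Nat.gcd 24 (totProd N) : ℤ)

/-- The eta-quotient `g(τ) = ∏_S η((N / P_S) τ) ^ (24 (-1)^{|S|} μ_N / gcd(24, P_N))`, where `S`
runs over all sets of prime divisors of `N`. The division `N / P_S` is exact. -/
def g (N : ℕ) (τ : UpperHalfPlane) : ℂ :=
  ∏ S ∈ N.primeFactors.powerset,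
    ModularForm.eta (((N / primeProd S : ℕ) : ℂ) * (τ : ℂ)) ^ exponent N S

/-- `f(τ) = ∑ c_n q^{n/h}` for all `τ` in the upper half-plane, with `q^{1/h} = exp(2πiτ/h)`,
where the `c_n` are the coefficients of the Laurent series `c`, so that `c_n = 0` for all
sufficiently negative `n`. -/
def HasFourierExpansion (h : ℕ) (f : UpperHalfPlane → ℂ) (c : LaurentSeries ℂ) : Prop :=
  ∀ τ : UpperHalfPlane,
    HasSum (fun n : ℤ ↦ c.coeff n * Function.Periodic.qParam (h : ℝ) (τ : ℂ) ^ n) (f τ)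

/-- A weakly holomorphic modular function on `Γ`: holomorphic on the upper half-plane,
`Γ`-invariant, and meromorphic at every cusp, i.e. for every `γ` in `SL₂(ℤ)` the function
`f ∘ γ` has a Fourier expansion in some `q^{1/h}` with finite principal part. -/
structure IsWeaklyHolomorphicModularFunction (Γ : Subgroup SL(2, ℤ))
    (f : UpperHalfPlane → ℂ) : Prop where
  holomorphic : MDifferentiable 𝓘(ℂ) 𝓘(ℂ) f
  invariant : ∀ γ ∈ Γ, ∀ τ : UpperHalfPlane, f (γ • τ) = f τ
  meromorphic_at_cusps : ∀ γ : SL(2, ℤ), ∃ h : ℕ, 0 < h ∧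
    ∃ c : LaurentSeries ℂ, HasFourierExpansion h (fun τ ↦ f (γ • τ)) c

/-- The Fourier coefficients of `f` with respect to `q = exp(2πiτ)` exist and are rational. -/
def HasRationalFourierCoefficients (f : UpperHalfPlane → ℂ) : Prop :=
  ∃ c : LaurentSeries ℂ, HasFourierExpansion 1 f c ∧ ∀ n : ℤ, ∃ r : ℚ, c.coeff n = (r : ℂ)

end EtaQuotient

end

namespace EtaQuotient

open Complex hiding eta
open ModularForm
open scoped NumberTheorySymbols Real

/-! ### Square roots on the slit plane -/

/-! For a matrix `(a, b; c, d)` of determinant one with `d` odd and positive, eta transforms with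
weight 1/2 and multiplier `J(c | d) ζ₂₄ ^ etaExponent` (`etaTransform_of_odd`). This is proved by
Euclidean descent on the bottom row, using only the translation and inversion formulas for eta.
Quadratic reciprocity makes the explicit multiplier compatible with each descent step.

If `δ = N / P_S` and `γ` has lower left entry `N c`, then `δ (γ τ)` is the image of `δ τ` under a
matrix with lower left entry `c P_S` and the same `d`. The weight factor is thus the same for all
`S`, and cancels because the exponents sum to zero. The powers of `ζ₂₄` cancel because `24` divides
both `∑ r_S P_S` and `∑ r_S N / P_S`; up to an integer factor, each sum is the common absolute
exponent times `P_N`. The Jacobi symbols cancel trivially for even exponents; an odd exponent forces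
two primes at least (the purpose of `μ_N`), and then subsets cancel by pairing
(`prod_jacobiSym_zpow`).

At a cusp, `‖g‖ ^ 24` is a constant times a product of powers of `‖Δ‖` at points of height
proportional to `im τ`, so it grows at most exponentially (`exists_g_smul_isBigO`). A power of the
local parameter makes `g ∘ γ` bounded, and its q-expansion gives the Laurent series. Rationality
holds because Euler products are limits of integer polynomials, and rational Taylor series with
nonzero constant term are stable under products and inverses. -/

lemma csqrt_sq (z : ℂ) : Complex.sqrt z ^ 2 = z := by
  change (z ^ (2⁻¹ : ℂ)) ^ 2 = z
  exact_mod_cast Complex.cpow_nat_inv_pow z two_ne_zero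

lemma csqrt_re_pos {z : ℂ} (hz : z ∈ slitPlane) : 0 < (Complex.sqrt z).re := by
  have h0 := slitPlane_ne_zero hz
  have hne : Complex.sqrt z = cexp (log z * 2⁻¹) := Complex.cpow_def_of_ne_zero h0 _
  rw [hne, Complex.exp_re]
  have him : (log z * 2⁻¹).im = arg z / 2 := by
    rw [show (2⁻¹ : ℂ) = ((2⁻¹ : ℝ) : ℂ) by simp, Complex.im_mul_ofReal, log_im]; ring
  rw [him]
  refine mul_pos (Real.exp_pos _) (Real.cos_pos_of_mem_Ioo ⟨?_, ?_⟩)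
  · linarith [neg_pi_lt_arg z]
  · linarith [(arg_le_pi z).lt_of_ne (mem_slitPlane_iff_arg.1 hz).1]

/-- Positivity of the real part singles out the principal root; this settles the sign ambiguity in
the cocycle relation `csqrt_mul_csqrt_add_one`. -/
lemma eq_csqrt_of_sq_eq {s z : ℂ} (h : s ^ 2 = z) (hs : 0 < s.re) : s = Complex.sqrt z := by
  have hz : z ∈ slitPlane := by
    rw [mem_slitPlane_iff]
    by_contra! hc
    rw [← h, sq, mul_re, mul_im] at hc
    have : s.im = 0 := by nlinarith
    simp only [this] at hc
    nlinarith
  rcases sq_eq_sq_iff_eq_or_eq_neg.1 (h.trans (csqrt_sq z).symm) with h' | h'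
  · exact h'
  · rw [h', neg_re] at hs
    linarith [csqrt_re_pos hz]

lemma csqrt_im_pos {z : ℂ} (hz : 0 < z.im) : 0 < (Complex.sqrt z).im := by
  have h1 : 0 < (Complex.sqrt z).re := csqrt_re_pos (mem_slitPlane_iff.2 (Or.inr hz.ne'))
  have h2 := congrArg Complex.im (csqrt_sq z)
  rw [sq, mul_im] at h2
  by_contra! hc
  nlinarith

lemma mul_add_mem_slitPlane {c d : ℤ} (hd : 0 < d) {τ : ℂ} (hτ : 0 < τ.im) :
    (c * τ + d : ℂ) ∈ slitPlane := by
  rw [mem_slitPlane_iff]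
  rcases eq_or_ne c 0 with rfl | hc
  · left; simpa using hd
  · right; simpa using ⟨hc, hτ.ne'⟩

lemma div_add_one_im_pos {τ : ℂ} (hτ : 0 < τ.im) : 0 < (τ / (τ + 1)).im := by
  have h1 : τ + 1 ≠ 0 := fun h ↦ by
    have := congrArg Complex.im h
    simp at this; exact hτ.ne' this
  have : 0 < normSq (τ + 1) := normSq_pos.2 h1
  rw [div_im, ← sub_div]
  refine div_pos ?_ this
  simp; nlinarith

lemma csqrt_mul_csqrt_add_one {c d : ℤ} (hd : 0 < d) {τ : ℂ} (hτ : 0 < τ.im) :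
    Complex.sqrt (c * (τ / (τ + 1)) + d) * Complex.sqrt (τ + 1)
      = Complex.sqrt (((c + d : ℤ) : ℂ) * τ + d) := by
  have h1 : τ + 1 ≠ 0 := fun h ↦ by
    have := congrArg Complex.im h
    simp at this; exact hτ.ne' this
  set A : ℂ := c * (τ / (τ + 1)) + d with hA
  have hw : 0 < (τ / (τ + 1)).im := div_add_one_im_pos hτ
  have hAB : A * (τ + 1) = ((c + d : ℤ) : ℂ) * τ + d := by
    rw [hA]; push_cast; field_simp; ring
  have hAs : A ∈ slitPlane := mul_add_mem_slitPlane hd hw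
  have hsq : (Complex.sqrt A * Complex.sqrt (τ + 1)) ^ 2 = ((c + d : ℤ) : ℂ) * τ + d := by
    rw [mul_pow, csqrt_sq, csqrt_sq, hAB]
  refine eq_csqrt_of_sq_eq hsq ?_
  have hB : 0 < (τ + 1).im := by simpa using hτ
  have x := csqrt_re_pos hAs
  have u := csqrt_re_pos (mem_slitPlane_iff.2 (Or.inr hB.ne'))
  have v := csqrt_im_pos hB
  -- If `√A` lies on or below the real axis, the real part of the product is visibly positive.
  -- Otherwise `c > 0`, so both the product and its square have positive imaginary part, which again
  -- forces a positive real part.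
  rcases le_or_gt (Complex.sqrt A).im 0 with hy | hy
  · rw [mul_re]; nlinarith [mul_pos x u]
  · have hs : 0 < (Complex.sqrt A * Complex.sqrt (τ + 1)).im := by
      rw [mul_im]; positivity
    have hAim : 0 < A.im := by
      rw [← csqrt_sq A, sq, mul_im]; positivity
    have hc : 0 < (c : ℝ) := by
      have : A.im = c * (τ / (τ + 1)).im := by simp [hA]
      rw [this] at hAim
      exact pos_of_mul_pos_left hAim hw.le
    have h3 := congrArg Complex.im hsq
    rw [sq, mul_im] at h3
    have h4 : (((c + d : ℤ) : ℂ) * τ + d).im = (c + d) * τ.im := by simp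
    rw [h4] at h3
    have : (0 : ℝ) < d := by exact_mod_cast hd
    have h5 : 0 < ((c : ℝ) + d) * τ.im := by positivity
    by_contra! hcon
    nlinarith

/-! ### The translation and inversion formulas -/

/-- The primitive root of unity `exp (2πi / 24)`. -/
noncomputable def zeta24 : ℂ := cexp (2 * π * I / 24)

lemma zeta24_ne_zero : zeta24 ≠ 0 := exp_ne_zero _

lemma zeta24_pow_twelve : zeta24 ^ 12 = -1 := by
  rw [zeta24, ← Complex.exp_nat_mul, ← Complex.exp_pi_mul_I]
  congr 1; push_cast; ring

lemma zeta24_zpow_twelve_mul (k : ℤ) : zeta24 ^ (12 * k) = (-1) ^ k := by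
  rw [zpow_mul]; congr 1; exact_mod_cast zeta24_pow_twelve

lemma zeta24_zpow_eq_one {k : ℤ} (hk : 24 ∣ k) : zeta24 ^ k = 1 := by
  obtain ⟨m, rfl⟩ := hk
  rw [show (24 : ℤ) * m = 12 * (2 * m) by ring, zeta24_zpow_twelve_mul, zpow_mul]
  simp

lemma eta_add_one (τ : ℂ) : eta (τ + 1) = zeta24 * eta τ := by
  have h1 : Function.Periodic.qParam 24 (τ + 1) = zeta24 * Function.Periodic.qParam 24 τ := by
    simp only [Function.Periodic.qParam, zeta24, ← Complex.exp_add]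
    congr 1; push_cast; ring
  have h2 : ∀ n, eta_q n (τ + 1) = eta_q n τ := fun n ↦ by
    have : Function.Periodic.qParam 1 (τ + 1) = Function.Periodic.qParam 1 τ := by
      simp only [Function.Periodic.qParam, ofReal_one, div_one, mul_add, mul_one]
      exact exp_periodic _
    simp [eta_q, this]
  simp only [eta, h1, h2, mul_assoc]

lemma eta_add_int (τ : ℂ) (n : ℤ) : eta (τ + n) = zeta24 ^ n * eta τ := by
  induction n using Int.induction_on with
  | zero => simp
  | succ n ih =>
    rw [zpow_add_one₀ zeta24_ne_zero, mul_comm (_ ^ _) zeta24, mul_assoc, ← ih, ← eta_add_one]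
    push_cast; rw [add_assoc]
  | pred n ih =>
    have := eta_add_one (τ + ((-n - 1 : ℤ) : ℂ))
    rw [show τ + ((-n - 1 : ℤ) : ℂ) + 1 = τ + ((-n : ℤ) : ℂ) by push_cast; ring, ih] at this
    rw [zpow_sub_one₀ zeta24_ne_zero, mul_comm (_ ^ _) _, mul_assoc, this,
      inv_mul_cancel_left₀ zeta24_ne_zero]

lemma eta_neg_inv {τ : ℂ} (hτ : 0 < τ.im) :
    eta (-1 / τ) = (Complex.sqrt I)⁻¹ * (Complex.sqrt τ * eta τ) := by
  simpa using eta_comp_eq_csqrt_I_inv hτ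

lemma eta_div_add_one {τ : ℂ} (hτ : 0 < τ.im) :
    eta (τ / (τ + 1)) = zeta24⁻¹ * Complex.sqrt (τ + 1) * eta τ := by
  have h0 : τ ≠ 0 := fun h ↦ by simp [h] at hτ
  have h1 : τ + 1 ≠ 0 := fun h ↦ by
    have := congrArg Complex.im h
    simp at this; exact hτ.ne' this
  set w : ℂ := -1 / τ with hw
  have hwim : 0 < w.im := by
    rw [hw, div_im]
    have : 0 < normSq τ := normSq_pos.2 h0
    simp only [neg_im, one_im, neg_zero, zero_mul, zero_div, neg_re, one_re, zero_sub]
    rw [← neg_div]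
    exact div_pos (by linarith) this
  have hwim' : 0 < (w + (-1 : ℤ)).im := by simpa using hwim
  -- The map `τ ↦ τ / (τ + 1)` is inversion, translation by `-1`, inversion.
  have e1 : τ / (τ + 1) = -1 / (w + (-1 : ℤ)) := by
    have : w + (-1 : ℤ) = -(τ + 1) / τ := by rw [hw]; push_cast; field_simp; ring
    rw [this]; field_simp
  rw [e1, eta_neg_inv hwim', eta_add_int, hw, eta_neg_inv hτ]
  have key : Complex.sqrt (-1 / τ + (-1 : ℤ)) * Complex.sqrt τ = I * Complex.sqrt (τ + 1) := by
    have hsq : (Complex.sqrt (-1 / τ + (-1 : ℤ)) * Complex.sqrt τ) ^ 2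
        = (I * Complex.sqrt (τ + 1)) ^ 2 := by
      rw [mul_pow, mul_pow, csqrt_sq, csqrt_sq, csqrt_sq, I_sq]; push_cast; field_simp; ring
    rcases sq_eq_sq_iff_eq_or_eq_neg.1 hsq with h | h
    · exact h
    · have := congrArg Complex.im h
      have hB : 0 < (τ + 1).im := by simpa using hτ
      have u := csqrt_re_pos (mem_slitPlane_iff.2 (Or.inr hB.ne'))
      have x1 := csqrt_re_pos (mem_slitPlane_iff.2 (Or.inr hwim'.ne'))
      have y1 := csqrt_im_pos hwim'
      have x2 := csqrt_re_pos (mem_slitPlane_iff.2 (Or.inr hτ.ne'))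
      have y2 := csqrt_im_pos hτ
      rw [neg_im, mul_im, mul_im, I_re, I_im] at this
      rw [hw] at x1 y1
      nlinarith [mul_pos x1 y2, mul_pos y1 x2]
  have hI : (Complex.sqrt I)⁻¹ * (Complex.sqrt I)⁻¹ = -I := by
    rw [← mul_inv, ← sq, csqrt_sq, inv_I]
  have : (Complex.sqrt I)⁻¹ * (Complex.sqrt (-1 / τ + (-1 : ℤ)) *
      (zeta24 ^ (-1 : ℤ) * ((Complex.sqrt I)⁻¹ * (Complex.sqrt τ * eta τ))))
      = ((Complex.sqrt I)⁻¹ * (Complex.sqrt I)⁻¹) *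
        (Complex.sqrt (-1 / τ + (-1 : ℤ)) * Complex.sqrt τ) * zeta24⁻¹ * eta τ := by
    rw [zpow_neg_one]; ring
  rw [this, key, hI]
  linear_combination (-(Complex.sqrt (τ + 1) * zeta24⁻¹ * eta τ)) * I_sq

end EtaQuotient

namespace EtaQuotient

open Complex hiding eta
open ModularForm
open scoped NumberTheorySymbols Real

/-! ### Two consequences of quadratic reciprocity -/

lemma jacobiSym_eq_of_emod_four_eq_one {v : ℤ} (hv : v % 4 = 1) {b : ℕ} (hb : Odd b) :
    J(v | b) = J(b | v.natAbs) := by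
  rcases le_or_gt 0 v with h | h
  · obtain ⟨n, rfl⟩ := Int.eq_ofNat_of_zero_le h
    exact jacobiSym.quadratic_reciprocity_one_mod_four (by omega) hb
  · obtain ⟨n, hn⟩ := Int.eq_ofNat_of_zero_le (show 0 ≤ -v by omega)
    obtain rfl : v = -(n : ℤ) := by omega
    have hn3 : n % 4 = 3 := by omega
    have hno : Odd n := Nat.odd_iff.2 (by omega)
    rw [jacobiSym.neg _ hb, Int.natAbs_neg, Int.natAbs_natCast]
    have hb2 := Nat.odd_iff.1 hb
    rcases Nat.odd_mod_four_iff.1 hb2 with h4 | h4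
    · rw [jacobiSym.quadratic_reciprocity_one_mod_four' hno h4, ZMod.χ₄_nat_one_mod_four h4,
        one_mul]
    · rw [jacobiSym.quadratic_reciprocity_three_mod_four hn3 h4, ZMod.χ₄_nat_three_mod_four h4]
      ring

/-- The symbol `J(c / 4 | d)` has period `4 |c / 4| = |c|` in `d`, and removing the square factor
`4` does not change it for odd `d`. -/
lemma jacobiSym_add_of_four_dvd {c : ℤ} (hc : 4 ∣ c) {d d' : ℕ} (hd : Odd d)
    (h : (d' : ℤ) = d + c) : J(c | d') = J(c | d) := by
  have hd2 := Nat.odd_iff.1 hd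
  have hd'2 : d' % 2 = 1 := by omega
  have hc4 : c % 4 = 0 := by omega
  rw [← jacobiSym.div_four_left hc4 hd2, ← jacobiSym.div_four_left hc4 hd'2,
    jacobiSym.mod_right _ hd, jacobiSym.mod_right _ (Nat.odd_iff.2 hd'2)]
  congr 1
  have h4 : 4 * (c / 4).natAbs = c.natAbs := by omega
  rw [h4]
  zify
  rw [h, Int.emod_abs, Int.emod_abs]
  simp

/-- One of `u`, `-u` is `1` modulo `4` and can be flipped by reciprocity, leaving a symbol of period
`|u|`. The factor `2` contributes the values of `χ₈`; the sign `-1` arises because `χ₄` changes sign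
between `d` and `d + 2 u`. -/
lemma jacobiSym_add_of_odd_half {u : ℤ} (hu : Odd u) {d d' : ℕ} (hd : Odd d)
    (h : (d' : ℤ) = d + 2 * u) :
    J(2 * u | d') = (if u % 4 = 1 then 1 else -1) * ZMod.χ₈ d * ZMod.χ₈ d' * J(2 * u | d) := by
  have hd2 := Nat.odd_iff.1 hd
  have hd' : Odd d' := Nat.odd_iff.2 (by omega)
  have hu2 := Int.odd_iff.1 hu
  have hmod : ∀ v : ℤ, v.natAbs = u.natAbs → J(d' | v.natAbs) = J(d | v.natAbs) := by
    intro v hv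
    rw [hv]
    refine jacobiSym.mod_left' ?_
    rw [h, Int.natCast_natAbs, Int.emod_abs, Int.emod_abs]
    simp
  have h8 : ZMod.χ₈ d * ZMod.χ₈ d = 1 := by
    rw [ZMod.χ₈_nat_eq_if_mod_eight]; split_ifs <;> omega
  rw [jacobiSym.mul_left, jacobiSym.mul_left, jacobiSym.at_two hd, jacobiSym.at_two hd']
  split_ifs with h1
  · rw [jacobiSym_eq_of_emod_four_eq_one h1 hd, jacobiSym_eq_of_emod_four_eq_one h1 hd',
      hmod u rfl]
    linear_combination (-ZMod.χ₈ d' * J(d | u.natAbs)) * h8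
  · have h1' : (-u) % 4 = 1 := by omega
    have e : ∀ b : ℕ, Odd b → J(u | b) = ZMod.χ₄ b * J(b | (-u).natAbs) := fun b hb ↦ by
      rw [← jacobiSym_eq_of_emod_four_eq_one h1' hb, ← jacobiSym.neg _ hb, neg_neg]
    have h4 : ZMod.χ₄ d' = - ZMod.χ₄ d := by
      rw [ZMod.χ₄_nat_eq_if_mod_four, ZMod.χ₄_nat_eq_if_mod_four]
      split_ifs <;> omega
    rw [e d hd, e d' hd', hmod (-u) (by simp), h4]
    linear_combination (ZMod.χ₈ d' * ZMod.χ₄ d * J(d | (-u).natAbs)) * h8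

/-! ### The multiplier of the eta function -/

/-- The exponent of `exp (2πi / 24)` in the multiplier of the eta function. -/
def etaExponent (a b c d : ℤ) : ℤ := a * c * (1 - d ^ 2) + d * (b - c + 3) - 3

/-- The multiplier of the eta function at the matrix `(a, b; c, d)`, for odd positive `d`. -/
noncomputable def etaMultiplier (a b c d : ℤ) : ℂ :=
  (J(c | d.natAbs) : ℂ) * zeta24 ^ etaExponent a b c d

lemma twentyFour_dvd_of {n : ℤ} (h3 : 3 ∣ n) (h8 : 8 ∣ n) : 24 ∣ n := by omega

lemma eight_dvd_one_sub_sq {d : ℤ} (hd : Odd d) : 8 ∣ 1 - d ^ 2 := by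
  have := Int.eight_dvd_sq_sub_one_of_odd hd
  rw [← neg_sub]; exact (dvd_neg).2 this

/-- The symbol depends only on `c` modulo `d`. The exponent drops by one modulo `24`, since the
error is a multiple of `d (1 - d ^ 2)`, divisible by `3` always and by `8` for odd `d`. -/
lemma etaMultiplier_add_left {a b c d : ℤ} (h : a * d - b * c = 1) (hd : Odd d) :
    etaMultiplier (a + b) b (c + d) d = etaMultiplier a b c d * zeta24⁻¹ := by
  have hJ : J(c + d | d.natAbs) = J(c | d.natAbs) := by
    refine jacobiSym.mod_left' ?_
    rw [Int.natCast_natAbs, Int.emod_abs, Int.emod_abs]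
    simp
  have hE : 24 ∣ etaExponent (a + b) b (c + d) d - etaExponent a b c d + 1 := by
    have e : etaExponent (a + b) b (c + d) d - etaExponent a b c d + 1
        = (1 - d ^ 2) * (2 * a * d + b * d) := by
      simp only [etaExponent]; linear_combination (d^2 - 1) * h
    rw [e]
    refine twentyFour_dvd_of ?_ ((eight_dvd_one_sub_sq hd).mul_right _)
    have : (1 - d ^ 2) * (2 * a * d + b * d) = ((1 - d ^ 2) * d) * (2 * a + b) := by ring
    rw [this]
    refine Dvd.dvd.mul_right ?_ _
    have : d % 3 = 0 ∨ d % 3 = 1 ∨ d % 3 = 2 := by omega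
    rw [Int.dvd_iff_emod_eq_zero]
    rcases this with h | h | h <;> simp [Int.mul_emod, Int.sub_emod, pow_two, h]
  rw [etaMultiplier, etaMultiplier, hJ]
  have := zeta24_zpow_eq_one hE
  rw [zpow_add₀ zeta24_ne_zero, zpow_sub₀ zeta24_ne_zero, zpow_one] at this
  have h0 := zeta24_ne_zero
  have h1 := zpow_ne_zero (etaExponent a b c d) h0
  field_simp at this ⊢
  linear_combination (J(c | d.natAbs) : ℂ) * this

/-- This is the case `c = 2 u`, `u` odd, of `etaMultiplier_add_right` modulo `8`: the sign acquired
by the Jacobi symbol matches the change of the exponent. The entry `a` is replaced by `d (1 + b c)`,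
as `d` is its own inverse modulo `8`. -/
lemma chi_eight_identity : ∀ b u d : ZMod 8, u ∈ ({1, 3, 5, 7} : Finset (ZMod 8)) →
    d ∈ ({1, 3, 5, 7} : Finset (ZMod 8)) →
    ((if u = 1 ∨ u = 5 then 1 else -1) * ZMod.χ₈ d * ZMod.χ₈ (d + 2 * u) = 1 ∧
      2 * u * (1 - 4 * u ^ 2) * (d * (1 + 2 * u * b) + 2 * b) + 6 * u * (1 - 2 * u) = 0) ∨
    ((if u = 1 ∨ u = 5 then 1 else -1) * ZMod.χ₈ d * ZMod.χ₈ (d + 2 * u) = -1 ∧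
      2 * u * (1 - 4 * u ^ 2) * (d * (1 + 2 * u * b) + 2 * b) + 6 * u * (1 - 2 * u) = 4) := by
  decide

end EtaQuotient

namespace EtaQuotient

open Complex hiding eta
open ModularForm
open scoped NumberTheorySymbols Real

lemma etaExponent_add_right {a b c d : ℤ} (h : a * d - b * c = 1) :
    etaExponent a (a + b) c (c + d) - etaExponent a b c d - 1
      = c * (1 - c ^ 2) * (a + 2 * b) + 3 * c * (1 - c) := by
  simp only [etaExponent]; linear_combination (1 - 2 * c ^ 2) * h

lemma three_dvd_etaExponent_add_right (a b c : ℤ) :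
    3 ∣ c * (1 - c ^ 2) * (a + 2 * b) + 3 * c * (1 - c) := by
  refine dvd_add (Dvd.dvd.mul_right ?_ _) (by rw [mul_assoc]; exact dvd_mul_right _ _)
  have : c % 3 = 0 ∨ c % 3 = 1 ∨ c % 3 = 2 := by omega
  rw [Int.dvd_iff_emod_eq_zero]
  rcases this with h | h | h <;> simp [Int.mul_emod, Int.sub_emod, pow_two, h]

lemma odd_intCast_zmod_eight {u : ℤ} (hu : Odd u) :
    (u : ZMod 8) ∈ ({1, 3, 5, 7} : Finset (ZMod 8)) := by
  obtain ⟨k, rfl⟩ := hu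
  push_cast
  generalize (k : ZMod 8) = x
  revert x; decide

lemma intCast_zmod_eight_eq_one_or_five_iff {u : ℤ} :
    ((u : ZMod 8) = 1 ∨ (u : ZMod 8) = 5) ↔ u % 4 = 1 := by
  have h1 : (u : ZMod 8) = 1 ↔ u % 8 = 1 := by
    have := ZMod.intCast_eq_intCast_iff' u 1 8
    simpa using this
  have h5 : (u : ZMod 8) = 5 ↔ u % 8 = 5 := by
    have := ZMod.intCast_eq_intCast_iff' u 5 8
    simpa using this
  rw [h1, h5]; omega

lemma etaMultiplier_add_right {a b c d : ℤ} (h : a * d - b * c = 1) (hc : Even c)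
    (hd0 : 0 < d) (hcd : 0 < c + d) :
    etaMultiplier a (a + b) c (c + d) = etaMultiplier a b c d * zeta24 := by
  have hd : Odd d := by
    by_contra hcon
    have h2 : (2 : ℤ) ∣ 1 := h ▸ dvd_sub ((Int.not_odd_iff_even.1 hcon).two_dvd.mul_left _)
      (hc.two_dvd.mul_left _)
    omega
  obtain ⟨n, rfl⟩ := Int.eq_ofNat_of_zero_le hd0.le
  obtain ⟨n', hn'⟩ := Int.eq_ofNat_of_zero_le hcd.le
  have hn : Odd n := by exact_mod_cast hd
  have hcd' : (n' : ℤ) = n + c := by rw [← hn']; ring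
  have hX3 := three_dvd_etaExponent_add_right a b c
  rw [← etaExponent_add_right h] at hX3
  have hX := etaExponent_add_right h
  have hζ : zeta24 ^ etaExponent a (a + b) c (c + n)
      = zeta24 ^ (etaExponent a (a + b) c (c + n) - etaExponent a b c n - 1) *
        (zeta24 ^ etaExponent a b c n * zeta24) := by
    rw [← zpow_add_one₀ zeta24_ne_zero, ← zpow_add₀ zeta24_ne_zero]; congr 1; ring
  rw [etaMultiplier, etaMultiplier, hζ, hn', Int.natAbs_natCast, Int.natAbs_natCast]
  rw [hn'] at hX hX3
  set X := etaExponent a (a + b) c n' - etaExponent a b c n - 1 with hXdef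
  rcases hc with ⟨u, hu⟩
  rcases Int.even_or_odd u with hue | huo
  · have h4 : 4 ∣ c := by rcases hue with ⟨k, rfl⟩; exact ⟨k, by omega⟩
    rw [jacobiSym_add_of_four_dvd h4 hn hcd']
    have hX8 : 8 ∣ X := by
      rw [hX]
      obtain ⟨k, rfl⟩ := h4
      have ha : Odd a := by
        by_contra hcon
        have h2 : (2 : ℤ) ∣ 1 := h ▸ dvd_sub ((Int.not_odd_iff_even.1 hcon).two_dvd.mul_right _)
          (Dvd.intro (b * 2 * k) (by ring))
        omega
      obtain ⟨m, rfl⟩ := ha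
      exact ⟨k * (m + b + 2) - 8 * k ^ 3 * (2 * m + 1 + 2 * b) - 6 * k ^ 2, by ring⟩
    rw [zeta24_zpow_eq_one (twentyFour_dvd_of hX3 hX8)]
    ring
  · obtain rfl : c = 2 * u := by omega
    rw [jacobiSym_add_of_odd_half huo hn hcd']
    have key := chi_eight_identity b u (n : ℤ) (odd_intCast_zmod_eight huo)
      (odd_intCast_zmod_eight hd)
    rw [show ((n : ℤ) : ZMod 8) + 2 * (u : ZMod 8) = ((n' : ℕ) : ZMod 8) by
      have := congrArg (Int.cast : ℤ → ZMod 8) hcd'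
      push_cast at this ⊢; exact this.symm] at key
    have hcast : (2 * (u : ZMod 8) * (1 - 4 * u ^ 2) *
        (((n : ℤ) : ZMod 8) * (1 + 2 * u * b) + 2 * b) + 6 * u * (1 - 2 * u)) = (X : ZMod 8) := by
      have hnn : ((n : ℤ) : ZMod 8) * ((n : ℤ) : ZMod 8) = 1 := by
        have := odd_intCast_zmod_eight hd
        generalize ((n : ℤ) : ZMod 8) = x at this
        revert x; decide
      have ha : (a : ZMod 8) = ((n : ℤ) : ZMod 8) * (1 + 2 * u * b) := by
        have := congrArg (Int.cast : ℤ → ZMod 8) h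
        push_cast at this hnn ⊢
        linear_combination (-(a : ZMod 8)) * hnn + (n : ZMod 8) * this
      rw [hX, ← ha]; push_cast; ring
    rw [hcast, show (((n : ℤ) : ZMod 8)) = ((n : ℕ) : ZMod 8) by simp] at key
    simp only [intCast_zmod_eight_eq_one_or_five_iff] at key
    have hJ : ∀ s : ℤ, (s : ℂ) * zeta24 ^ X = 1 →
        ((s * J(2 * u | n) : ℤ) : ℂ) * (zeta24 ^ X * (zeta24 ^ etaExponent a b (2 * u) n * zeta24))
          = J(2 * u | n) * zeta24 ^ etaExponent a b (2 * u) n * zeta24 := by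
      intro s hs
      push_cast
      linear_combination (J(2 * u | n) * zeta24 ^ etaExponent a b (2 * u) n * zeta24) * hs
    refine hJ _ ?_
    rcases key with ⟨h1, h2⟩ | ⟨h1, h2⟩
    · have h8 : (8 : ℤ) ∣ X := by exact_mod_cast (ZMod.intCast_zmod_eq_zero_iff_dvd X 8).1 h2
      rw [h1, zeta24_zpow_eq_one (twentyFour_dvd_of hX3 h8)]; simp
    · have h8 : (8 : ℤ) ∣ X - 4 := by
        have : ((X - 4 : ℤ) : ZMod 8) = 0 := by push_cast; rw [h2]; decide
        exact_mod_cast (ZMod.intCast_zmod_eq_zero_iff_dvd _ 8).1 this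
      -- Being `4` modulo `8` and divisible by `3`, `X` is an odd multiple of `12`, so `ζ₂₄ ^ X =
      -- -1`.
      obtain ⟨k, hk⟩ : ∃ k, X = 12 * (2 * k + 1) := ⟨(X / 12 - 1) / 2, by omega⟩
      rw [h1, hk, zeta24_zpow_twelve_mul, zpow_add₀ (by norm_num), zpow_mul]; simp

/-! ### The transformation formula of the eta function -/

/-- The transformation formula of the eta function under the matrix `(a, b; c, d)`. -/
def EtaTransform (a b c d : ℤ) : Prop :=
  ∀ τ : ℂ, 0 < τ.im → eta ((a * τ + b) / (c * τ + d))
    = etaMultiplier a b c d * Complex.sqrt (c * τ + d) * eta τ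

lemma etaTransform_add_right_iff {a b c d : ℤ} (h : a * d - b * c = 1) (hc : Even c)
    (hd0 : 0 < d) (hcd : 0 < c + d) :
    EtaTransform a (a + b) c (c + d) ↔ EtaTransform a b c d := by
  have key : ∀ τ : ℂ, (eta ((a * τ + (a + b : ℤ)) / (c * τ + (c + d : ℤ)))
      = etaMultiplier a (a + b) c (c + d) * Complex.sqrt (c * τ + (c + d : ℤ)) * eta τ) ↔
      (eta ((a * (τ + 1) + b) / (c * (τ + 1) + d))
      = etaMultiplier a b c d * Complex.sqrt (c * (τ + 1) + d) * eta (τ + 1)) := fun τ ↦ by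
    rw [etaMultiplier_add_right h hc hd0 hcd, eta_add_one,
      show (a * τ + (a + b : ℤ) : ℂ) = a * (τ + 1) + b by push_cast; ring,
      show (c * τ + (c + d : ℤ) : ℂ) = c * (τ + 1) + d by push_cast; ring]
    constructor <;> intro h <;> rw [h] <;> ring
  constructor
  · intro H τ hτ
    simpa using (key (τ - 1)).1 (H (τ - 1) (by simpa using hτ))
  · intro H τ hτ
    exact (key τ).2 (H (τ + 1) (by simpa using hτ))

lemma etaTransform_add_left_iff {a b c d : ℤ} (h : a * d - b * c = 1) (hd : Odd d)
    (hd0 : 0 < d) : EtaTransform (a + b) b (c + d) d ↔ EtaTransform a b c d := by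
  have key : ∀ τ : ℂ, 0 < τ.im → ((eta (((a + b : ℤ) * τ + b) / ((c + d : ℤ) * τ + d))
      = etaMultiplier (a + b) b (c + d) d * Complex.sqrt ((c + d : ℤ) * τ + d) * eta τ) ↔
      (eta ((a * (τ / (τ + 1)) + b) / (c * (τ / (τ + 1)) + d)) = etaMultiplier a b c d *
        Complex.sqrt (c * (τ / (τ + 1)) + d) * eta (τ / (τ + 1)))) := fun τ hτ ↦ by
    have h1 : τ + 1 ≠ 0 := fun h ↦ by
      have := congrArg Complex.im h
      simp at this; exact hτ.ne' this
    rw [etaMultiplier_add_left h hd, eta_div_add_one hτ, ← csqrt_mul_csqrt_add_one hd0 hτ]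
    have e : (((a + b : ℤ) : ℂ) * τ + b) / (((c + d : ℤ) : ℂ) * τ + d)
        = (a * (τ / (τ + 1)) + b) / (c * (τ / (τ + 1)) + d) := by
      rw [show (((a + b : ℤ) : ℂ) * τ + b) = (a * (τ / (τ + 1)) + b) * (τ + 1) by
          push_cast; field_simp; ring,
        show (((c + d : ℤ) : ℂ) * τ + d) = (c * (τ / (τ + 1)) + d) * (τ + 1) by
          push_cast; field_simp; ring, mul_div_mul_right _ _ h1]
    rw [e]
    constructor <;> intro h <;> rw [h] <;> ring
  constructor
  · intro H w hw
    have h1 : 1 - w ≠ 0 := fun h ↦ by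
      have := congrArg Complex.im h
      simp at this; exact hw.ne' this
    have hτ : 0 < (w / (1 - w)).im := by
      have : 0 < normSq (1 - w) := normSq_pos.2 h1
      rw [div_im, ← sub_div]
      refine div_pos ?_ this
      simp; nlinarith
    have e : w / (1 - w) / (w / (1 - w) + 1) = w := by
      rw [show w / (1 - w) + 1 = 1 / (1 - w) by field_simp; ring]; field_simp
    have := (key _ hτ).1 (H _ hτ)
    rwa [e] at this
  · intro H τ hτ
    exact (key τ hτ).2 (H _ (div_add_one_im_pos hτ))

lemma etaTransform_add_mul_left_iff {a b c d : ℤ} (h : a * d - b * c = 1) (hd : Odd d)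
    (hd0 : 0 < d) (k : ℤ) :
    EtaTransform (a + k * b) b (c + k * d) d ↔ EtaTransform a b c d := by
  have hk : ∀ k : ℤ, EtaTransform (a + (k + 1) * b) b (c + (k + 1) * d) d ↔
      EtaTransform (a + k * b) b (c + k * d) d := fun k ↦ by
    rw [← etaTransform_add_left_iff (a := a + k * b) (by linear_combination h) hd hd0, add_one_mul,
      add_one_mul, add_assoc, add_assoc]
  induction k using Int.induction_on with
  | zero => simp
  | succ n ih => exact (hk _).trans ih
  | pred n ih =>
    have := hk (-n - 1)
    rw [sub_add_cancel] at this
    exact this.symm.trans ih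

/-- The transformation formula of the eta function, for matrices whose lower right entry is odd
and positive. -/
theorem etaTransform_of_odd {a b c d : ℤ} (h : a * d - b * c = 1) (hd : Odd d) (hd0 : 0 < d) :
    EtaTransform a b c d := by
  obtain ⟨n, hn⟩ : ∃ n : ℕ, d.natAbs = n := ⟨_, rfl⟩
  induction n using Nat.strong_induction_on generalizing a b c d with
  | _ n ih =>
  -- As `d` is odd, exactly one of `c % d` and `c % d - d` is even. With `c` even, passing from `d`
  -- to `d - |c|` keeps `d` odd and positive.
  obtain ⟨k, hk, hk'⟩ : ∃ k : ℤ, Even (c + k * d) ∧ |c + k * d| < d := by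
    have h1 := Int.emod_add_mul_ediv c d
    have h2 := Int.emod_nonneg c hd0.ne'
    have h3 := Int.emod_lt_of_pos c hd0
    rcases Int.even_or_odd (c % d) with he | ho
    · refine ⟨-(c / d), ?_, ?_⟩
      · rwa [show c + -(c / d) * d = c % d by linear_combination -h1]
      · rw [show c + -(c / d) * d = c % d by linear_combination -h1, abs_of_nonneg h2]
        exact h3
    · refine ⟨-(c / d) - 1, ?_, ?_⟩
      · rw [show c + (-(c / d) - 1) * d = c % d - d by linear_combination -h1]
        exact ho.sub_odd hd
      · rw [show c + (-(c / d) - 1) * d = c % d - d by linear_combination -h1, abs_lt]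
        have : c % d ≠ 0 := by rintro h0; simp [h0] at ho
        omega
  rw [← etaTransform_add_mul_left_iff h hd hd0 k]
  have h' : (a + k * b) * d - b * (c + k * d) = 1 := by linear_combination h
  generalize a + k * b = a' at h' ⊢
  generalize c + k * d = c' at h' hk hk' ⊢
  rw [abs_lt] at hk'
  rcases lt_trichotomy c' 0 with hc | rfl | hc
  · rw [← etaTransform_add_right_iff h' hk hd0 (by omega)]
    exact ih (c' + d).natAbs (by omega) (by linear_combination h') (hk.add_odd hd) (by omega) rfl
  · obtain rfl : d = 1 := Int.eq_one_of_mul_eq_one_left hd0.le (by linarith : a' * d = 1)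
    obtain rfl : a' = 1 := by linarith
    intro τ _
    have : etaExponent 1 b 0 1 = b := by simp [etaExponent]
    simp [etaMultiplier, this, eta_add_int]
  · have e := etaTransform_add_right_iff (a := a') (b := b - a') (c := c') (d := d - c')
      (by linear_combination h') hk (by omega) (by omega)
    rw [add_sub_cancel, add_sub_cancel] at e
    rw [e]
    exact ih (d - c').natAbs (by omega) (by linear_combination h') (hd.sub_even hk) (by omega) rfl

end EtaQuotient

namespace EtaQuotient

open Complex hiding eta
open ModularForm
open scoped NumberTheorySymbols Real

/-! ### The exponents -/

/-- The absolute value of the exponents of the eta-quotient. -/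
def absExponent (N : ℕ) : ℤ := (24 / Nat.gcd 24 (totProd N) : ℕ) * (mu N : ℤ)

lemma gcd_mul_div_gcd (N : ℕ) :
    Nat.gcd 24 (totProd N) * (24 / Nat.gcd 24 (totProd N)) = 24 :=
  Nat.mul_div_cancel' (Nat.gcd_dvd_left _ _)

lemma exponent_eq (N : ℕ) (S : Finset ℕ) : exponent N S = (-1) ^ S.card * absExponent N := by
  have h := gcd_mul_div_gcd N
  have hpos : 0 < Nat.gcd 24 (totProd N) := Nat.gcd_pos_of_pos_left _ (by norm_num)
  rw [exponent, absExponent]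
  set k := 24 / Nat.gcd 24 (totProd N)
  have h' : ((Nat.gcd 24 (totProd N) : ℕ) : ℤ) * k = 24 := by exact_mod_cast h
  refine Int.ediv_eq_of_eq_mul_right (by exact_mod_cast hpos.ne') ?_
  linear_combination (-(-1) ^ S.card * (mu N : ℤ)) * h'

lemma dvd_absExponent_mul_totProd (N : ℕ) : 24 ∣ absExponent N * (totProd N : ℤ) := by
  have h := gcd_mul_div_gcd N
  obtain ⟨m, hm⟩ := Nat.gcd_dvd_right 24 (totProd N)
  rw [absExponent]
  set k := 24 / Nat.gcd 24 (totProd N)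
  have h' : ((Nat.gcd 24 (totProd N) : ℕ) : ℤ) * k = 24 := by exact_mod_cast h
  have hm' : (totProd N : ℤ) = (Nat.gcd 24 (totProd N) : ℤ) * m := by exact_mod_cast hm
  exact ⟨mu N * m, by rw [hm']; linear_combination (mu N * m : ℤ) * h'⟩

lemma primeProd_dvd {N : ℕ} {S : Finset ℕ} (hS : S ∈ N.primeFactors.powerset) :
    primeProd S ∣ N :=
  (Finset.prod_dvd_prod_of_subset _ _ _ (Finset.mem_powerset.1 hS)).trans
    (Nat.prod_primeFactors_dvd N)

lemma primeProd_pos {N : ℕ} {S : Finset ℕ} (hS : S ∈ N.primeFactors.powerset) :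
    0 < primeProd S :=
  Finset.prod_pos fun _ hp ↦ (Nat.prime_of_mem_primeFactors (Finset.mem_powerset.1 hS hp)).pos

lemma div_primeProd_pos {N : ℕ} (hN : 2 ≤ N) {S : Finset ℕ} (hS : S ∈ N.primeFactors.powerset) :
    0 < N / primeProd S :=
  Nat.div_pos (Nat.le_of_dvd (by omega) (primeProd_dvd hS)) (primeProd_pos hS)

lemma primeFactors_nonempty {N : ℕ} (hN : 2 ≤ N) : N.primeFactors.Nonempty :=
  Nat.nonempty_primeFactors.2 hN

lemma sum_exponent {N : ℕ} (hN : 2 ≤ N) : ∑ S ∈ N.primeFactors.powerset, exponent N S = 0 := by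
  simp_rw [exponent_eq, ← Finset.sum_mul]
  rw [Finset.sum_powerset_neg_one_pow_card_of_nonempty (primeFactors_nonempty hN), zero_mul]

lemma natCast_totProd (N : ℕ) : (totProd N : ℤ) = ∏ p ∈ N.primeFactors, ((p : ℤ) - 1) := by
  rw [totProd, Nat.cast_prod]
  refine Finset.prod_congr rfl fun p hp ↦ ?_
  rw [Nat.cast_sub (Nat.prime_of_mem_primeFactors hp).one_le]; simp

lemma dvd_sum_exponent_mul_primeProd (N : ℕ) :
    24 ∣ ∑ S ∈ N.primeFactors.powerset, exponent N S * (primeProd S : ℤ) := by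
  have h := Finset.prod_sub (fun _ ↦ (1 : ℤ)) (fun p : ℕ ↦ (p : ℤ)) N.primeFactors
  have e : ∑ S ∈ N.primeFactors.powerset, exponent N S * (primeProd S : ℤ)
      = absExponent N * ∏ p ∈ N.primeFactors, (1 - (p : ℤ)) := by
    rw [h, Finset.mul_sum]
    refine Finset.sum_congr rfl fun S _ ↦ ?_
    rw [exponent_eq, primeProd]; push_cast; simp; ring
  rw [e, show ∏ p ∈ N.primeFactors, (1 - (p : ℤ))
      = (-1) ^ N.primeFactors.card * (totProd N : ℤ) by
    rw [natCast_totProd, ← Finset.prod_neg]; simp, mul_left_comm]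
  exact (dvd_absExponent_mul_totProd N).mul_left _

lemma dvd_sum_exponent_mul_div_primeProd (N : ℕ) :
    24 ∣ ∑ S ∈ N.primeFactors.powerset, exponent N S * ((N / primeProd S : ℕ) : ℤ) := by
  have h := Finset.prod_sub (fun p : ℕ ↦ (p : ℤ)) (fun _ ↦ (1 : ℤ)) N.primeFactors
  obtain ⟨M, hM⟩ := Nat.prod_primeFactors_dvd N
  have e : ∑ S ∈ N.primeFactors.powerset, exponent N S * ((N / primeProd S : ℕ) : ℤ)
      = M * (absExponent N * (totProd N : ℤ)) := by
    rw [natCast_totProd, h, Finset.mul_sum, Finset.mul_sum]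
    refine Finset.sum_congr rfl fun S hS ↦ ?_
    have : N / primeProd S = M * ∏ p ∈ N.primeFactors \ S, p := by
      refine Nat.div_eq_of_eq_mul_left (primeProd_pos hS) ?_
      rw [primeProd, mul_assoc, Finset.prod_sdiff (Finset.mem_powerset.1 hS), mul_comm]
      exact hM
    rw [exponent_eq, this]; push_cast; simp; ring
  rw [e]
  exact (dvd_absExponent_mul_totProd N).mul_left _

/-- With a single prime `p`, oddness of `24 / gcd(24, p - 1)` forces `8 ∣ p - 1`; but then `mu N =
2` and the exponent is even. -/
lemma two_le_card_primeFactors {N : ℕ} (hN : 2 ≤ N) (h : Odd (absExponent N)) :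
    2 ≤ N.primeFactors.card := by
  by_contra! hlt
  have h1 : N.primeFactors.card = 1 := by
    have := (primeFactors_nonempty hN).card_pos; omega
  obtain ⟨p, hp⟩ := Finset.card_eq_one.1 h1
  obtain ⟨hk, hmu⟩ := Int.odd_mul.1 h
  rw [Int.odd_coe_nat] at hk hmu
  have hp8 : p ≡ 1 [MOD 8] := by
    have h8 : 8 ∣ Nat.gcd 24 (totProd N) := by
      have hcop : Nat.Coprime 8 (24 / Nat.gcd 24 (totProd N)) :=
        Nat.Coprime.pow_left 3 (Nat.coprime_two_left.2 hk)
      refine hcop.dvd_of_dvd_mul_right ?_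
      rw [gcd_mul_div_gcd]; norm_num
    have h8' := h8.trans (Nat.gcd_dvd_right _ _)
    rw [totProd, hp, Finset.prod_singleton] at h8'
    have hpp : p.Prime := Nat.prime_of_mem_primeFactors (n := N) (by rw [hp]; simp)
    exact ((Nat.modEq_iff_dvd' hpp.one_le).2 h8').symm
  have : mu N = 2 := by
    rw [mu, if_pos]
    exact ⟨h1, fun q hq ↦ by rw [hp, Finset.mem_singleton] at hq; rwa [hq]⟩
  rw [this] at hmu
  exact absurd hmu (by decide)

/-- Fix `p ∈ A` and pair `S` with `insert p S`: each pair contributes `f p`, and the number of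
pairs, `2 ^ (A.card - 1)`, is even. -/
lemma prod_powerset_eq_one {A : Finset ℕ} (hA : 2 ≤ A.card) {F : Finset ℕ → ℤ} {f : ℕ → ℤ}
    (hF : ∀ S ∈ A.powerset, F S ^ 2 = 1) (hf : ∀ p ∈ A, f p ^ 2 = 1)
    (hFf : ∀ S ⊆ A, ∀ p ∈ A, p ∉ S → F (insert p S) = f p * F S) :
    ∏ S ∈ A.powerset, F S = 1 := by
  obtain ⟨p, hp⟩ : A.Nonempty := Finset.card_pos.1 (by omega)
  have hcard : (A.erase p).card = A.card - 1 := Finset.card_erase_of_mem hp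
  have e : ∏ S ∈ (insert p (A.erase p)).powerset, F S = 1 := by
    rw [Finset.prod_powerset_insert (Finset.notMem_erase _ _), ← Finset.prod_mul_distrib,
      Finset.prod_congr rfl (g := fun _ ↦ f p), Finset.prod_const, Finset.card_powerset, hcard,
      show A.card - 1 = (A.card - 2) + 1 by omega, pow_succ', pow_mul, hf p hp, one_pow]
    intro S hS
    have hS' := Finset.mem_powerset.1 hS
    have hSA := hS'.trans (Finset.erase_subset _ _)
    rw [hFf S hSA p hp (fun h ↦ Finset.notMem_erase p A (hS' h))]
    linear_combination f p * hF S (Finset.mem_powerset.2 hSA)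
  rwa [Finset.insert_erase hp] at e

lemma prod_jacobiSym_zpow {N : ℕ} (hN : 2 ≤ N) {c : ℤ} {n : ℕ} (h : IsCoprime (N * c) (n : ℤ)) :
    ∏ S ∈ N.primeFactors.powerset, (J(c * primeProd S | n) : ℂ) ^ exponent N S = 1 := by
  have hcop : ∀ S ∈ N.primeFactors.powerset, J(c * primeProd S | n) ^ 2 = 1 := by
    intro S hS
    refine jacobiSym.sq_one (Int.isCoprime_iff_gcd_eq_one.1 (h.of_isCoprime_of_dvd_left ?_))
    rw [mul_comm]
    exact mul_dvd_mul_right (Int.natCast_dvd_natCast.2 (primeProd_dvd hS)) _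
  have e : ∀ S ∈ N.primeFactors.powerset, (J(c * primeProd S | n) : ℂ) ^ exponent N S
      = (J(c * primeProd S | n) : ℂ) ^ absExponent N := by
    intro S hS
    rw [exponent_eq]
    rcases neg_one_pow_eq_or ℤ S.card with h1 | h1
    · rw [h1, one_mul]
    · rw [h1, neg_one_mul, zpow_neg, ← inv_zpow]
      rcases sq_eq_sq_iff_eq_or_eq_neg.1 ((hcop S hS).trans (one_pow 2).symm) with h2 | h2 <;>
        simp [h2]
  rw [Finset.prod_congr rfl e, Finset.prod_zpow]
  rcases Int.even_or_odd (absExponent N) with ⟨k, hk⟩ | ho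
  · rw [hk, ← two_mul, zpow_mul, ← Finset.prod_zpow]
    rw [Finset.prod_eq_one, one_zpow]
    intro S hS
    exact_mod_cast hcop S hS
  · rw [← Int.cast_prod, prod_powerset_eq_one (two_le_card_primeFactors hN ho) hcop
      (f := fun p ↦ J(p | n))]
    · simp
    · intro p hp
      refine jacobiSym.sq_one (Int.isCoprime_iff_gcd_eq_one.1 (h.of_isCoprime_of_dvd_left ?_))
      exact (Int.natCast_dvd_natCast.2 (Nat.dvd_of_mem_primeFactors hp)).mul_right _
    · intro S _ p _ hpS
      rw [← jacobiSym.mul_left, primeProd, primeProd, Finset.prod_insert hpS]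
      push_cast; ring_nf

end EtaQuotient

namespace EtaQuotient

open Complex hiding eta
open ModularForm UpperHalfPlane
open scoped NumberTheorySymbols Real

/-! ### Invariance under `Γ₀(N)` -/

lemma coe_SL_smul (γ : SL(2, ℤ)) (τ : ℍ) :
    ((γ • τ : ℍ) : ℂ) = (γ 0 0 * τ + γ 0 1) / (γ 1 0 * τ + γ 1 1) := by
  rw [UpperHalfPlane.coe_specialLinearGroup_apply]; simp

lemma SL_det_eq (γ : SL(2, ℤ)) : γ 0 0 * γ 1 1 - γ 0 1 * γ 1 0 = 1 := by
  have := γ.det_coe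
  rwa [Matrix.det_fin_two] at this

lemma eta_mul_smul {γ : SL(2, ℤ)} (hd : Odd (γ 1 1)) (hd0 : 0 < γ 1 1) {δ c : ℤ} (hδ : 0 < δ)
    (hc : γ 1 0 = c * δ) (τ : ℍ) :
    eta (δ * ((γ • τ : ℍ) : ℂ)) = etaMultiplier (γ 0 0) (γ 0 1 * δ) c (γ 1 1) *
      Complex.sqrt (γ 1 0 * τ + γ 1 1) * eta (δ * τ) := by
  have hdet : γ 0 0 * γ 1 1 - (γ 0 1 * δ) * c = 1 := by
    linear_combination SL_det_eq γ + γ 0 1 * hc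
  have him : 0 < ((δ : ℂ) * τ).im := by
    simpa using mul_pos (Int.cast_pos.2 hδ) τ.im_pos
  have := etaTransform_of_odd hdet hd hd0 (δ * τ) him
  rw [coe_SL_smul]
  rw [show (c : ℂ) * (δ * τ) = γ 1 0 * τ by rw [hc]; push_cast; ring] at this
  rw [← this]
  congr 1
  push_cast; ring

lemma prod_zpow_eq_zpow_sum {ι K : Type*} [Field K] {x : K} (hx : x ≠ 0) (s : Finset ι)
    (f : ι → ℤ) : ∏ i ∈ s, x ^ f i = x ^ ∑ i ∈ s, f i := by
  classical
  induction s using Finset.induction_on with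
  | empty => simp
  | insert i s hi ih => rw [Finset.prod_insert hi, Finset.sum_insert hi, ih, zpow_add₀ hx]

lemma g_smul_of_odd {N : ℕ} (hN : 2 ≤ N) {γ : SL(2, ℤ)} (hγ : γ ∈ CongruenceSubgroup.Gamma0 N)
    (hd : Odd (γ 1 1)) (hd0 : 0 < γ 1 1) (τ : ℍ) : g N (γ • τ) = g N τ := by
  obtain ⟨c, hc⟩ : (N : ℤ) ∣ γ 1 0 :=
    (ZMod.intCast_zmod_eq_zero_iff_dvd _ _).1 (CongruenceSubgroup.Gamma0_mem.1 hγ)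
  set s := Complex.sqrt (γ 1 0 * τ + γ 1 1) with hs
  have hs0 : s ≠ 0 := by
    intro h0
    have := csqrt_re_pos (mul_add_mem_slitPlane (c := γ 1 0) hd0 τ.im_pos)
    rw [← hs, h0] at this
    simp at this
  have key : ∀ S ∈ N.primeFactors.powerset,
      eta (((N / primeProd S : ℕ) : ℂ) * ((γ • τ : ℍ) : ℂ)) ^ exponent N S
      = (J(c * primeProd S | (γ 1 1).natAbs) : ℂ) ^ exponent N S *
        zeta24 ^ (etaExponent (γ 0 0) (γ 0 1 * (N / primeProd S : ℕ)) (c * primeProd S) (γ 1 1)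
          * exponent N S) * s ^ exponent N S *
        eta (((N / primeProd S : ℕ) : ℂ) * τ) ^ exponent N S := by
    intro S hS
    have hNS : ((N / primeProd S : ℕ) : ℤ) * primeProd S = N := by
      exact_mod_cast Nat.div_mul_cancel (primeProd_dvd hS)
    have := eta_mul_smul hd hd0 (δ := (N / primeProd S : ℕ)) (c := c * primeProd S)
      (by exact_mod_cast div_primeProd_pos hN hS) (by rw [hc, ← hNS]; ring) τ
    rw [Int.cast_natCast] at this
    rw [this, etaMultiplier, mul_zpow, mul_zpow, mul_zpow, zpow_mul]
  rw [g, Finset.prod_congr rfl key, Finset.prod_mul_distrib, Finset.prod_mul_distrib,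
    Finset.prod_mul_distrib, ← g, prod_zpow_eq_zpow_sum hs0, sum_exponent hN,
    prod_zpow_eq_zpow_sum zeta24_ne_zero, prod_jacobiSym_zpow hN, zeta24_zpow_eq_one]
  · simp
  · have e : ∑ S ∈ N.primeFactors.powerset,
        etaExponent (γ 0 0) (γ 0 1 * (N / primeProd S : ℕ)) (c * primeProd S) (γ 1 1)
          * exponent N S
        = (γ 0 0 * c * (1 - γ 1 1 ^ 2) - γ 1 1 * c) *
            ∑ S ∈ N.primeFactors.powerset, exponent N S * (primeProd S : ℤ)
          + (γ 1 1 * γ 0 1) *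
            ∑ S ∈ N.primeFactors.powerset, exponent N S * ((N / primeProd S : ℕ) : ℤ)
          + (3 * γ 1 1 - 3) * ∑ S ∈ N.primeFactors.powerset, exponent N S := by
      simp only [Finset.mul_sum, ← Finset.sum_add_distrib]
      refine Finset.sum_congr rfl fun S _ ↦ ?_
      rw [etaExponent]; ring
    rw [e, sum_exponent hN, mul_zero, add_zero]
    exact dvd_add ((dvd_sum_exponent_mul_primeProd N).mul_left _)
      ((dvd_sum_exponent_mul_div_primeProd N).mul_left _)
  · rw [← hc, Int.natCast_natAbs, abs_of_pos hd0]
    exact ModularGroup.bottom_row_coprime γ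

lemma g_smul {N : ℕ} (hN : 2 ≤ N) {γ : SL(2, ℤ)} (hγ : γ ∈ CongruenceSubgroup.Gamma0 N) (τ : ℍ) :
    g N (γ • τ) = g N τ := by
  have hodd : ∀ γ ∈ CongruenceSubgroup.Gamma0 N, Odd (γ 1 1) → ∀ τ : ℍ, g N (γ • τ) = g N τ := by
    intro γ hγ hd τ
    rcases lt_trichotomy (γ 1 1) 0 with h | h | h
    · have hγ' : -γ ∈ CongruenceSubgroup.Gamma0 N := by
        rw [CongruenceSubgroup.Gamma0_mem] at hγ ⊢
        simpa using hγ
      rw [← g_smul_of_odd hN hγ' (by simpa using hd) (by simpa using h) τ]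
      congr 1
      ext1
      rw [coe_SL_smul, coe_SL_smul]
      simp only [Matrix.SpecialLinearGroup.coe_neg, Matrix.neg_apply, Int.cast_neg]
      rw [← neg_div_neg_eq]; ring_nf
    · simp [h] at hd
    · exact g_smul_of_odd hN hγ hd h τ
  -- For even `d` the entry `c` is odd, so `γ * T` and `T` both have odd lower right entry, and
  -- invariance under these two gives invariance under `γ`.
  rcases Int.even_or_odd (γ 1 1) with he | ho
  · have hT : ModularGroup.T ∈ CongruenceSubgroup.Gamma0 N := by
      rw [CongruenceSubgroup.Gamma0_mem]; simp [ModularGroup.T]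
    have hc : Odd (γ 1 0) := by
      by_contra hcon
      have h2 : (2 : ℤ) ∣ 1 := SL_det_eq γ ▸ dvd_sub (he.two_dvd.mul_left _)
        ((Int.not_odd_iff_even.1 hcon).two_dvd.mul_left _)
      omega
    have h1 := hodd (γ * ModularGroup.T) (mul_mem hγ hT)
      (by
        rw [Matrix.SpecialLinearGroup.coe_mul, ModularGroup.coe_T]
        simpa [Matrix.mul_apply, Fin.sum_univ_two] using hc.add_even he)
      (ModularGroup.T⁻¹ • τ)
    have h2 := hodd ModularGroup.T hT (by simp [ModularGroup.T]) (ModularGroup.T⁻¹ • τ)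
    rw [mul_smul, smul_inv_smul] at h1
    rw [smul_inv_smul] at h2
    rw [h1, h2]
  · exact hodd γ hγ ho τ

/-! ### Holomorphy -/

lemma mdifferentiable_g {N : ℕ} (hN : 2 ≤ N) : MDifferentiable 𝓘(ℂ) 𝓘(ℂ) (g N) := by
  rw [UpperHalfPlane.mdifferentiable_iff]
  have : DifferentiableOn ℂ (fun z : ℂ ↦ ∏ S ∈ N.primeFactors.powerset,
      eta (((N / primeProd S : ℕ) : ℂ) * z) ^ exponent N S) {z | 0 < z.im} := by
    refine DifferentiableOn.fun_finsetProd fun S hS z hz ↦ ?_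
    have hpos : 0 < (((N / primeProd S : ℕ) : ℂ) * z).im := by
      simpa using mul_pos (Nat.cast_pos.2 (div_primeProd_pos hN hS)) hz
    have h1 : DifferentiableAt ℂ (fun z : ℂ ↦ eta (((N / primeProd S : ℕ) : ℂ) * z)) z :=
      (differentiableAt_eta_of_mem_upperHalfPlaneSet hpos).comp z (by fun_prop)
    exact (h1.zpow (Or.inl (eta_ne_zero hpos))).differentiableWithinAt
  refine this.congr fun z hz ↦ ?_
  simp [g, ofComplex_apply_of_im_pos hz]

end EtaQuotient

namespace EtaQuotient

open Complex hiding eta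
open ModularForm Filter Asymptotics
open UpperHalfPlane hiding I
open scoped Real

/-! ### Laurent expansions -/

lemma hasFourierExpansion_of_hasSum {h : ℕ} {f : ℍ → ℂ} (M : ℤ) (p : PowerSeries ℂ)
    (H : ∀ τ : ℍ, HasSum (fun m : ℕ ↦ p.coeff m * Function.Periodic.qParam h τ ^ m)
      (f τ * Function.Periodic.qParam h τ ^ (-M))) :
    HasFourierExpansion h f (HahnSeries.single M 1 * (p : LaurentSeries ℂ)) := by
  intro τ
  set q := Function.Periodic.qParam h (τ : ℂ) with hq
  have hq0 : q ≠ 0 := Function.Periodic.qParam_ne_zero _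
  have hinj : Function.Injective (fun m : ℕ ↦ (m : ℤ) + M) := fun a b hab ↦ by
    simpa using hab
  rw [← hinj.hasSum_iff]
  · have := (H τ).mul_right (q ^ M)
    rw [mul_assoc, ← zpow_add₀ hq0, neg_add_cancel, zpow_zero, mul_one] at this
    refine this.congr_fun fun m ↦ ?_
    simp [HahnSeries.coeff_single_mul, ← hq, zpow_add₀ hq0, mul_assoc]
  · intro n hn
    have : n - M < 0 := by
      by_contra! hcon
      exact hn ⟨(n - M).toNat, by simp only; omega⟩
    rw [HahnSeries.coeff_single_mul, PowerSeries.coeff_coe, if_pos this]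
    simp

/-! ### Growth of the discriminant -/

lemma norm_discriminant_smul (γ : SL(2, ℤ)) (z : ℍ) :
    ‖discriminant (γ • z)‖ * (γ • z).im ^ 6 = ‖discriminant z‖ * z.im ^ 6 := by
  have h := congrFun
    (SlashInvariantForm.slash_action_generators_SL2Z discriminant_S_invariant
      discriminant_T_invariant γ) z
  rw [SL_slash_apply] at h
  have hd : denom γ z ≠ 0 := denom_ne_zero γ z
  rw [← h, norm_mul, ModularGroup.im_smul_eq_div_normSq, norm_zpow, div_pow,
    Complex.normSq_eq_norm_sq, ← pow_mul, zpow_neg]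
  have : ‖denom γ z‖ ≠ 0 := norm_ne_zero_iff.2 hd
  field_simp

/-- Some `γ'` in `SL₂(ℤ)` makes `γ' (δ, 0; 0, 1) γ` upper triangular: its bottom row is proportional
to `(-γ 1 0, δ γ 0 0)`. Invariance of `‖Δ‖ im ^ 6` under `γ'` then transfers eta at `δ (γ τ)` to `Δ`
at a point of height `A ^ 2 / δ * im τ`, where `A` is the gcd. -/
lemma exists_norm_eta_pow (γ : SL(2, ℤ)) {δ : ℕ} (hδ : 0 < δ) :
    ∃ κ K : ℝ, ∃ t : ℍ → ℍ, 0 < κ ∧ (∀ τ, (t τ).im = κ * τ.im) ∧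
      ∀ τ : ℍ, ‖eta (δ * ((γ • τ : ℍ) : ℂ))‖ ^ 24
        = K * ‖discriminant (t τ)‖ * ((τ.im / (γ • τ).im) ^ 6) := by
  have hgcd : 0 < Int.gcd (δ * γ 0 0) (γ 1 0) := by
    rw [Nat.pos_iff_ne_zero, Ne, Int.gcd_eq_zero_iff]
    rintro ⟨h1, h2⟩
    have h3 : γ 0 0 = 0 := by
      rcases mul_eq_zero.1 h1 with h | h
      · exact absurd h (by exact_mod_cast hδ.ne')
      · exact h
    have := SL_det_eq γ
    simp [h3, h2] at this
  obtain ⟨A, x, y, hA, hxy, hx, hy⟩ := Int.exists_gcd_one' hgcd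
  obtain ⟨γ', -, hγ'⟩ := ModularGroup.bottom_row_surj (R := ℤ)
    (show ![-y, x] ∈ {cd : Fin 2 → ℤ | IsCoprime (cd 0) (cd 1)} by
      simpa [IsCoprime.neg_left_iff] using (Int.isCoprime_iff_gcd_eq_one.2 hxy).symm)
  have h10 : γ' 1 0 = -y := by simpa using congrFun hγ' 0
  have h11 : γ' 1 1 = x := by simpa using congrFun hγ' 1
  have hδ' : (0 : ℝ) < δ := by exact_mod_cast hδ
  have hA' : (0 : ℝ) < A := by exact_mod_cast hA
  let w : ℍ → ℍ := fun τ ↦ ⟨δ * ((γ • τ : ℍ) : ℂ), by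
    simpa using mul_pos hδ' (γ • τ).im_pos⟩
  have hw : ∀ τ, (w τ).im = δ * (γ • τ).im := fun τ ↦ by
    rw [← coe_im]; simp [w]
  have him : ∀ τ, (γ' • w τ).im = (A ^ 2 / δ : ℝ) * τ.im := by
    intro τ
    have hden : denom γ τ ≠ 0 := denom_ne_zero γ τ
    have hden' : denom γ τ = γ 1 0 * τ + γ 1 1 := by
      rw [ModularGroup.denom_apply]
    have e : denom γ' (w τ) = (δ / A : ℝ) / denom γ τ := by
      rw [ModularGroup.denom_apply, h10, h11]
      have hw' : ((w τ : ℍ) : ℂ) = δ * ((γ 0 0 * τ + γ 0 1) / denom γ τ) := by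
        rw [hden', ← coe_SL_smul]
      have hAC : (A : ℂ) ≠ 0 := by exact_mod_cast hA.ne'
      have hxC : (δ : ℂ) * γ 0 0 = x * A := by exact_mod_cast hx
      have hyC : (γ 1 0 : ℂ) = y * A := by exact_mod_cast hy
      have hdetC : (γ 0 0 : ℂ) * γ 1 1 - γ 0 1 * γ 1 0 = 1 := by exact_mod_cast SL_det_eq γ
      rw [hw']
      push_cast
      field_simp
      rw [hden']
      linear_combination (-(γ 1 0 * τ + γ 1 1 : ℂ)) * hxC
        + (δ * (γ 0 0 * τ + γ 0 1) : ℂ) * hyC + δ * hdetC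
    rw [ModularGroup.im_smul_eq_div_normSq, hw, ModularGroup.im_smul_eq_div_normSq, e,
      map_div₀, Complex.normSq_ofReal]
    have : Complex.normSq (denom γ τ) ≠ 0 := by simp
    field_simp
  refine ⟨A ^ 2 / δ, (A ^ 2 / δ / δ) ^ 6, fun τ ↦ γ' • w τ, by positivity, him, fun τ ↦ ?_⟩
  have h := norm_discriminant_smul γ' (w τ)
  have h2 : ‖discriminant (w τ)‖ = ‖eta (δ * ((γ • τ : ℍ) : ℂ))‖ ^ 24 := by
    rw [discriminant, norm_pow]
  rw [him, hw, h2] at h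
  have hpos := (γ • τ).im_pos
  field_simp at h ⊢
  linear_combination -h

lemma discriminant_zpow_isBigO (r : ℤ) : (fun z : ℍ ↦ ‖discriminant z‖ ^ r) =O[atImInfty]
    fun z ↦ Real.exp (2 * π * |r| * z.im) := by
  rcases le_or_gt 0 r with hr | hr
  · obtain ⟨n, rfl⟩ := Int.eq_ofNat_of_zero_le hr
    have h1 : (fun z : ℍ ↦ ‖discriminant z‖) =O[atImInfty] fun z : ℍ ↦ (1 : ℝ) :=
      ((discriminant_isZeroAtImInfty.isBigO_one ℝ).norm_left)
    have h2 := (h1.pow n).trans (g := fun z : ℍ ↦ (1 : ℝ) ^ n)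
      (k := fun z : ℍ ↦ Real.exp (2 * π * |(n : ℤ)| * z.im)) ?_
    · simpa using h2
    · refine IsBigO.of_norm_le fun z ↦ ?_
      simp only [one_pow, norm_one]
      refine Real.one_le_exp ?_
      have := z.im_pos
      positivity
  · obtain ⟨n, hn⟩ := Int.eq_ofNat_of_zero_le (show 0 ≤ -r by omega)
    obtain rfl : r = -(n : ℤ) := by omega
    have h1 := exp_isBigO_discriminant.norm_right.inv_rev (by simp [Real.exp_ne_zero])
    have h2 := h1.pow n
    refine (h2.congr' ?_ ?_)
    · exact Eventually.of_forall fun z ↦ by simp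
    · refine Eventually.of_forall fun z ↦ ?_
      simp only [← Real.exp_neg, ← Real.exp_nat_mul]
      congr 1
      simp; ring

end EtaQuotient

namespace EtaQuotient

open Complex hiding eta
open ModularForm Filter Asymptotics
open UpperHalfPlane hiding I
open scoped Real

/-! ### Behaviour at the cusps -/

lemma exists_g_smul_isBigO {N : ℕ} (hN : 2 ≤ N) (γ : SL(2, ℤ)) :
    ∃ B : ℝ, (fun τ : ℍ ↦ ‖g N (γ • τ)‖ ^ 24) =O[atImInfty] fun τ ↦ Real.exp (B * τ.im) := by
  have H : ∀ S : Finset ℕ, ∃ κ K : ℝ, ∃ t : ℍ → ℍ, S ∈ N.primeFactors.powerset → 0 < κ ∧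
      (∀ τ, (t τ).im = κ * τ.im) ∧
      ∀ τ : ℍ, ‖eta (((N / primeProd S : ℕ) : ℂ) * ((γ • τ : ℍ) : ℂ))‖ ^ 24
        = K * ‖discriminant (t τ)‖ * ((τ.im / (γ • τ).im) ^ 6) := by
    intro S
    by_cases hS : S ∈ N.primeFactors.powerset
    · obtain ⟨κ, K, t, h⟩ := exists_norm_eta_pow γ (div_primeProd_pos hN hS)
      exact ⟨κ, K, t, fun _ ↦ h⟩
    · exact ⟨0, 0, id, fun h ↦ absurd h hS⟩
  choose κ K t h using H
  refine ⟨∑ S ∈ N.primeFactors.powerset, 2 * π * |exponent N S| * κ S, ?_⟩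
  have e : ∀ τ : ℍ, ‖g N (γ • τ)‖ ^ 24 = (∏ S ∈ N.primeFactors.powerset, K S ^ exponent N S) *
      ∏ S ∈ N.primeFactors.powerset, ‖discriminant (t S τ)‖ ^ exponent N S := by
    intro τ
    have hX : (τ.im / (γ • τ).im) ^ 6 ≠ 0 :=
      pow_ne_zero _ (div_pos τ.im_pos (γ • τ).im_pos).ne'
    have : ∀ S ∈ N.primeFactors.powerset,
        (‖eta (((N / primeProd S : ℕ) : ℂ) * ((γ • τ : ℍ) : ℂ)) ^ exponent N S‖) ^ 24
        = K S ^ exponent N S * ‖discriminant (t S τ)‖ ^ exponent N S *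
          ((τ.im / (γ • τ).im) ^ 6) ^ exponent N S := fun S hS ↦ by
      rw [← mul_zpow, ← mul_zpow, ← (h S hS).2.2 τ, norm_zpow, ← zpow_natCast, ← zpow_mul,
        mul_comm (exponent N S), zpow_mul, zpow_natCast]
    rw [g, norm_prod, ← Finset.prod_pow, Finset.prod_congr rfl this, Finset.prod_mul_distrib,
      Finset.prod_mul_distrib, prod_zpow_eq_zpow_sum hX, sum_exponent hN, zpow_zero, mul_one]
  simp_rw [e]
  refine IsBigO.const_mul_left ?_ _
  have e2 : ∀ τ : ℍ, Real.exp ((∑ S ∈ N.primeFactors.powerset,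
      2 * π * |exponent N S| * κ S) * τ.im) = ∏ S ∈ N.primeFactors.powerset,
        Real.exp (2 * π * |exponent N S| * (κ S * τ.im)) := fun τ ↦ by
    rw [← Real.exp_sum, Finset.sum_mul]
    simp only [mul_assoc]
  simp_rw [e2]
  refine IsBigO.finsetProd fun S hS ↦ ?_
  obtain ⟨hκ, him, -⟩ := h S hS
  have ht : Tendsto (t S) atImInfty atImInfty := by
    rw [atImInfty, tendsto_comap_iff]
    have : UpperHalfPlane.im ∘ t S = fun τ ↦ κ S * τ.im := funext him
    rw [this]
    exact tendsto_comap.const_mul_atTop hκ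
  have := (discriminant_zpow_isBigO (exponent N S)).comp_tendsto ht
  simpa only [Function.comp_def, him] using this

/-- `T ^ N` lies in the normal subgroup `Γ(N)`, so its conjugates lie in `Γ₀(N)`; hence `N` is a
period at every cusp. -/
lemma g_smul_add {N : ℕ} (hN : 2 ≤ N) (γ : SL(2, ℤ)) (τ : ℍ) :
    g N (γ • (((N : ℝ) +ᵥ τ : ℍ))) = g N (γ • τ) := by
  have hT : ModularGroup.T ^ (N : ℤ) ∈ CongruenceSubgroup.Gamma N := by
    simpa using CongruenceSubgroup.ModularGroup_T_pow_mem_Gamma N N dvd_rfl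
  have hconj := (CongruenceSubgroup.Gamma_normal N).conj_mem _ hT γ
  have hmem : γ * ModularGroup.T ^ (N : ℤ) * γ⁻¹ ∈ CongruenceSubgroup.Gamma0 N :=
    CongruenceSubgroup.Gamma0_mem.2 (CongruenceSubgroup.Gamma_mem.1 hconj).2.2.1
  rw [← g_smul hN hmem (γ • τ), ← mul_smul, inv_mul_cancel_right, mul_smul,
    UpperHalfPlane.modular_T_zpow_smul]
  simp

lemma exists_hasFourierExpansion_g_smul {N : ℕ} (hN : 2 ≤ N) (γ : SL(2, ℤ)) :
    ∃ h : ℕ, 0 < h ∧ ∃ c : LaurentSeries ℂ, HasFourierExpansion h (fun τ ↦ g N (γ • τ)) c := by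
  have hN0 : (0 : ℝ) < N := by exact_mod_cast (by omega : 0 < N)
  obtain ⟨B, hB⟩ := exists_g_smul_isBigO hN γ
  -- The 24th power of `‖q ^ M‖`, with `q` the parameter of width `N`, is `exp (-48 π M im τ / N)`;
  -- this `M` makes it absorb `exp (B im τ)`.
  obtain ⟨M, hM⟩ := exists_nat_ge (B * N / (48 * π))
  set F : ℍ → ℂ := fun τ ↦ g N (γ • τ) * Function.Periodic.qParam N τ ^ M with hF
  have hper : Function.Periodic (F ∘ ofComplex) ((N : ℝ) : ℂ) := by
    intro z
    rcases lt_or_ge 0 z.im with hz | hz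
    · have hz' : 0 < (z + (N : ℝ)).im := by simpa using hz
      have e : (⟨z + (N : ℝ), hz'⟩ : ℍ) = (N : ℝ) +ᵥ (⟨z, hz⟩ : ℍ) := by
        ext; simp [add_comm]
      have hq : Function.Periodic.qParam N (z + (N : ℝ)) = Function.Periodic.qParam N z := by
        have hN0' : (N : ℂ) ≠ 0 := by exact_mod_cast hN0.ne'
        simp only [Function.Periodic.qParam, ofReal_natCast]
        rw [show 2 * π * I * (z + N) / N = 2 * π * I * z / N + 2 * π * I by field_simp]
        exact exp_periodic _
      rw [Function.comp_apply, Function.comp_apply, ofComplex_apply_of_im_pos hz',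
        ofComplex_apply_of_im_pos hz, hF]
      simp only [hq]
      rw [e, g_smul_add hN]
    -- Off the upper half-plane `ofComplex` takes one default value, so periodicity is automatic
    -- there.
    · have hz' : (z + (N : ℝ)).im ≤ 0 := by simpa using hz
      rw [Function.comp_apply, Function.comp_apply, ofComplex_apply_of_im_nonpos hz,
        ofComplex_apply_of_im_nonpos hz']
  have hhol : MDifferentiable 𝓘(ℂ) 𝓘(ℂ) F := by
    have h1 : MDifferentiable 𝓘(ℂ) 𝓘(ℂ) fun τ : ℍ ↦ g N (γ • τ) :=
      (mdifferentiable_g hN).comp (mdifferentiable_smul (by simp))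
    have h2 : MDifferentiable 𝓘(ℂ) 𝓘(ℂ) fun τ : ℍ ↦ Function.Periodic.qParam N τ ^ M := by
      rw [UpperHalfPlane.mdifferentiable_iff]
      have : DifferentiableOn ℂ (fun z ↦ Function.Periodic.qParam N z ^ M) {z | 0 < z.im} := by
        fun_prop
      exact this.congr fun z hz ↦ by simp [ofComplex_apply_of_im_pos hz]
    exact h1.mul h2
  have hbdd : IsBoundedAtImInfty F := by
    have h1 : (fun τ : ℍ ↦ ‖F τ‖ ^ 24) =O[atImInfty] fun τ : ℍ ↦ (1 : ℝ) ^ 24 := by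
      have h2 := hB.mul (isBigO_refl (fun τ : ℍ ↦ ‖Function.Periodic.qParam N τ ^ M‖ ^ 24) _)
      refine (h2.congr_left fun τ ↦ by rw [hF, norm_mul, mul_pow]).trans ?_
      refine IsBigO.of_norm_le fun τ ↦ ?_
      rw [one_pow, norm_pow, Function.Periodic.norm_qParam, ← pow_mul, ← Real.exp_nat_mul,
        ← Real.exp_add, Real.norm_of_nonneg (Real.exp_nonneg _), Real.exp_le_one_iff]
      have h3 : B * N ≤ M * (48 * π) := (div_le_iff₀ (by positivity)).1 hM
      have h4 : B * τ.im + ((M * 24 : ℕ) : ℝ) * (-2 * π * (τ : ℂ).im / N)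
          = (B * N - M * (48 * π)) * τ.im / N := by
        rw [coe_im]; push_cast; field_simp; ring
      rw [h4]
      exact div_nonpos_of_nonpos_of_nonneg
        (mul_nonpos_of_nonpos_of_nonneg (by linarith) τ.im_pos.le) hN0.le
    exact (IsBigO.of_pow (n := 24) (by norm_num) h1).of_norm_left
  refine ⟨N, by omega, _, hasFourierExpansion_of_hasSum (-(M : ℤ)) (qExpansion N F) fun τ ↦ ?_⟩
  simpa [hF] using hasSum_qExpansion hN0 hper hhol hbdd τ

end EtaQuotient

namespace EtaQuotient

open Complex hiding eta
open ModularForm Filter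
open UpperHalfPlane hiding I
open scoped Real Topology

/-! ### Functions with rational Taylor coefficients -/

/-- The Taylor series of a function at `0`. -/
noncomputable def taylorSeries (G : ℂ → ℂ) : PowerSeries ℂ :=
  .mk fun m ↦ (m.factorial : ℂ)⁻¹ * iteratedDeriv m G 0

lemma taylorSeries_mul {G H : ℂ → ℂ} (hG : AnalyticAt ℂ G 0) (hH : AnalyticAt ℂ H 0) :
    taylorSeries (G * H) = taylorSeries G * taylorSeries H := by
  ext
  simp only [taylorSeries, PowerSeries.coeff_mk, iteratedDeriv_mul hG.contDiffAt hH.contDiffAt,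
    Finset.mul_sum, PowerSeries.coeff_mul, Finset.Nat.sum_antidiagonal_eq_sum_range_succ_mk,
    Nat.succ_eq_add_one]
  refine Finset.sum_congr rfl fun i hi ↦ ?_
  rw [Nat.cast_choose _ (by grind)]
  field_simp [Nat.factorial_ne_zero]

lemma taylorSeries_congr {G H : ℂ → ℂ} (h : G =ᶠ[𝓝 0] H) : taylorSeries G = taylorSeries H := by
  ext n
  simp only [taylorSeries, PowerSeries.coeff_mk, h.iteratedDeriv_eq n]

lemma taylorSeries_one : taylorSeries 1 = 1 := by
  ext n
  rw [taylorSeries, PowerSeries.coeff_mk, PowerSeries.coeff_one, Pi.one_def, iteratedDeriv_const]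
  split_ifs with h <;> simp [h]

/-- The function `G` is analytic at `0`, with rational Taylor coefficients. -/
def HasRationalTaylorSeries (G : ℂ → ℂ) : Prop :=
  AnalyticAt ℂ G 0 ∧ ∃ p : PowerSeries ℚ, taylorSeries G = p.map (algebraMap ℚ ℂ)

lemma HasRationalTaylorSeries.one : HasRationalTaylorSeries 1 :=
  ⟨analyticAt_const, 1, by simp [taylorSeries_one]⟩

lemma HasRationalTaylorSeries.mul {G H : ℂ → ℂ} (hG : HasRationalTaylorSeries G)
    (hH : HasRationalTaylorSeries H) : HasRationalTaylorSeries (G * H) := by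
  obtain ⟨hG, p, hp⟩ := hG
  obtain ⟨hH, r, hr⟩ := hH
  exact ⟨hG.mul hH, p * r, by rw [taylorSeries_mul hG hH, hp, hr, map_mul]⟩

lemma HasRationalTaylorSeries.inv {G : ℂ → ℂ} (hG : HasRationalTaylorSeries G) (h0 : G 0 ≠ 0) :
    HasRationalTaylorSeries G⁻¹ := by
  obtain ⟨hG, p, hp⟩ := hG
  refine ⟨hG.inv h0, p⁻¹, ?_⟩
  have h1 : taylorSeries G⁻¹ * taylorSeries G = 1 := by
    rw [← taylorSeries_mul (hG.inv h0) hG, ← taylorSeries_one]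
    refine taylorSeries_congr ?_
    filter_upwards [hG.continuousAt.eventually_ne h0] with z hz
    simp [hz]
  have hp0 : p.constantCoeff ≠ 0 := by
    intro hcon
    have := congrArg (PowerSeries.coeff 0) hp
    rw [PowerSeries.coeff_map, PowerSeries.coeff_zero_eq_constantCoeff_apply p, hcon] at this
    simp [taylorSeries] at this
    exact h0 this
  calc taylorSeries G⁻¹ = taylorSeries G⁻¹ * (p * p⁻¹).map (algebraMap ℚ ℂ) := by
        rw [PowerSeries.mul_inv_cancel _ hp0, map_one, mul_one]
    _ = _ := by rw [map_mul, ← hp, ← mul_assoc, h1, one_mul]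

lemma HasRationalTaylorSeries.zpow {G : ℂ → ℂ} (hG : HasRationalTaylorSeries G) (h0 : G 0 ≠ 0)
    (r : ℤ) : HasRationalTaylorSeries (G ^ r) := by
  have hpow : ∀ n : ℕ, HasRationalTaylorSeries (G ^ n) := fun n ↦ by
    induction n with
    | zero => simpa using HasRationalTaylorSeries.one
    | succ n ih => rw [pow_succ]; exact ih.mul hG
  rcases Int.eq_nat_or_neg r with ⟨n, rfl | rfl⟩
  · simpa using hpow n
  · rw [zpow_neg, zpow_natCast]
    exact (hpow n).inv (by simpa using fun h ↦ absurd h h0)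

lemma HasRationalTaylorSeries.prod {ι : Type*} (s : Finset ι) {G : ι → ℂ → ℂ}
    (h : ∀ i ∈ s, HasRationalTaylorSeries (G i)) : HasRationalTaylorSeries (∏ i ∈ s, G i) :=
  Finset.prod_induction _ _ (fun _ _ ↦ HasRationalTaylorSeries.mul) HasRationalTaylorSeries.one h

/-- The derivatives at `0` of a locally uniform limit of integer polynomials are integers. -/
lemma exists_iteratedDeriv_eq_intCast {ι : Type*} {l : Filter ι} [l.NeBot]
    {P : ι → Polynomial ℤ} {f : ℂ → ℂ} {U : Set ℂ} (hU : IsOpen U) (h0 : (0 : ℂ) ∈ U)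
    (h : TendstoLocallyUniformlyOn (fun i z ↦ Polynomial.aeval z (P i)) f l U) (k : ℕ) :
    ∃ m : ℤ, iteratedDeriv k f 0 = m := by
  induction k generalizing P f with
  | zero =>
    have ht := h.tendsto_at h0
    have : f 0 ∈ Set.range ((↑) : ℤ → ℂ) := by
      -- The integers are closed in `ℂ`, so a limit of integer constant terms is an integer. Higher
      -- derivatives reduce to this, since locally uniform convergence of holomorphic functions
      -- passes to derivatives.
      refine Complex.isClosed_range_intCast.mem_of_tendsto ht (Eventually.of_forall fun i ↦ ?_)
      exact ⟨(P i).coeff 0, by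
        rw [← Polynomial.coeff_zero_eq_aeval_zero', eq_intCast]⟩
    obtain ⟨m, hm⟩ := this
    exact ⟨m, by simp [hm]⟩
  | succ k ih =>
    rw [iteratedDeriv_succ']
    refine ih (P := fun i ↦ (P i).derivative) ?_
    have := h.deriv (Eventually.of_forall fun i ↦
      (Polynomial.differentiable_aeval _).differentiableOn) hU
    refine this.congr fun i z _ ↦ ?_
    simp

/-! ### The expansion at infinity -/

/-- The Euler product `∏ (1 - q ^ n)` as a function of `q`. -/
noncomputable def eulerProduct (q : ℂ) : ℂ := ∏' n : ℕ, (1 - q ^ (n + 1))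

lemma pow_mem_ball {δ : ℕ} (hδ : 0 < δ) {q : ℂ} (hq : q ∈ Metric.ball (0 : ℂ) 1) :
    q ^ δ ∈ Metric.ball (0 : ℂ) 1 := by
  simp only [mem_ball_zero_iff, norm_pow] at hq ⊢
  exact pow_lt_one₀ (norm_nonneg _) hq hδ.ne'

lemma eulerProduct_ne_zero {q : ℂ} (hq : q ∈ Metric.ball (0 : ℂ) 1) : eulerProduct q ≠ 0 := by
  have hq' : ‖q‖ < 1 := by simpa using hq
  have := tprod_one_add_ne_zero_of_summable (f := fun n : ℕ ↦ -q ^ (n + 1)) ?_ ?_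
  · simpa [eulerProduct, sub_eq_add_neg] using this
  · intro n h
    have h1 : q ^ (n + 1) = 1 := by linear_combination -h
    have h2 : ‖q‖ ^ (n + 1) = 1 := by rw [← norm_pow, h1, norm_one]
    exact (pow_lt_one₀ (norm_nonneg q) hq' n.succ_ne_zero).ne h2
  · simpa using (summable_nat_add_iff 1).mpr (summable_geometric_of_lt_one (norm_nonneg _) hq')

lemma differentiableOn_eulerProduct_pow {δ : ℕ} (hδ : 0 < δ) :
    DifferentiableOn ℂ (fun q ↦ eulerProduct (q ^ δ)) (Metric.ball 0 1) :=
  differentiableOn_tprod_one_sub_pow.comp (by fun_prop) fun _ hq ↦ pow_mem_ball hδ hq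

lemma hasRationalTaylorSeries_eulerProduct_pow {δ : ℕ} (hδ : 0 < δ) :
    HasRationalTaylorSeries (fun q ↦ eulerProduct (q ^ δ)) := by
  have h0 : (0 : ℂ) ∈ Metric.ball (0 : ℂ) 1 := by simp
  refine ⟨(differentiableOn_eulerProduct_pow hδ).analyticAt (Metric.isOpen_ball.mem_nhds h0), ?_⟩
  have hlim : TendstoLocallyUniformlyOn (fun (s : Finset ℕ) (z : ℂ) ↦ Polynomial.aeval z
      (∏ n ∈ s, (1 - (Polynomial.X ^ δ) ^ (n + 1)) : Polynomial ℤ))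
      (fun q ↦ eulerProduct (q ^ δ)) atTop (Metric.ball 0 1) := by
    have := hasProdLocallyUniformlyOn_iff_tendstoLocallyUniformlyOn.1
      multipliableLocallyUniformlyOn_one_sub_pow.hasProdLocallyUniformlyOn
    have h2 := this.comp (fun q : ℂ ↦ q ^ δ) (fun _ hq ↦ pow_mem_ball hδ hq) (by fun_prop)
    refine h2.congr fun s z _ ↦ ?_
    simp
  choose m hm using exists_iteratedDeriv_eq_intCast Metric.isOpen_ball h0 hlim
  refine ⟨.mk fun k ↦ (k.factorial : ℚ)⁻¹ * m k, ?_⟩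
  ext k
  simp [taylorSeries, hm]

lemma qParam_one_mul (δ : ℕ) (z : ℂ) :
    Function.Periodic.qParam 1 (δ * z) = Function.Periodic.qParam 1 z ^ δ := by
  simp only [Function.Periodic.qParam, ← Complex.exp_nat_mul]
  congr 1; push_cast; ring

lemma qParam_twentyFour_mul (δ : ℕ) (z : ℂ) :
    Function.Periodic.qParam 24 (δ * z) = Function.Periodic.qParam 24 z ^ δ := by
  simp only [Function.Periodic.qParam, ← Complex.exp_nat_mul]
  congr 1; push_cast; ring

lemma qParam_twentyFour_pow (z : ℂ) :
    Function.Periodic.qParam 24 z ^ 24 = Function.Periodic.qParam 1 z := by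
  simp only [Function.Periodic.qParam, ← Complex.exp_nat_mul]
  congr 1; push_cast; ring

lemma eta_natCast_mul (δ : ℕ) (z : ℂ) : eta (δ * z)
    = Function.Periodic.qParam 24 z ^ δ * eulerProduct (Function.Periodic.qParam 1 z ^ δ) := by
  simp only [eta, eta_q, eulerProduct, qParam_twentyFour_mul, qParam_one_mul]

theorem hasRationalFourierCoefficients_g {N : ℕ} (hN : 2 ≤ N) :
    HasRationalFourierCoefficients (g N) := by
  -- The factors `q ^ (1/24)` of the etas combine to the integral power `q ^ M`; the rest is a
  -- function `G` of `q`, holomorphic on the unit disc.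
  obtain ⟨M, hM⟩ := dvd_sum_exponent_mul_div_primeProd N
  set G : ℂ → ℂ := ∏ S ∈ N.primeFactors.powerset,
    (fun q ↦ eulerProduct (q ^ (N / primeProd S))) ^ exponent N S with hG
  have h0 : (0 : ℂ) ∈ Metric.ball (0 : ℂ) 1 := by simp
  have hdiff : DifferentiableOn ℂ G (Metric.ball 0 1) := by
    refine DifferentiableOn.finsetProd fun S hS z hz ↦ ?_
    have hδ := div_primeProd_pos hN hS
    exact (differentiableOn_eulerProduct_pow hδ z hz).zpow
      (Or.inl (eulerProduct_ne_zero (pow_mem_ball hδ hz)))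
  obtain ⟨-, p, hp⟩ : HasRationalTaylorSeries G :=
    HasRationalTaylorSeries.prod _ fun S hS ↦
      (hasRationalTaylorSeries_eulerProduct_pow (div_primeProd_pos hN hS)).zpow
        (eulerProduct_ne_zero (pow_mem_ball (div_primeProd_pos hN hS) h0)) _
  have hg : ∀ τ : ℍ, g N τ * Function.Periodic.qParam 1 τ ^ (-M)
      = G (Function.Periodic.qParam 1 τ) := by
    intro τ
    have hq0 : Function.Periodic.qParam 24 (τ : ℂ) ≠ 0 := Function.Periodic.qParam_ne_zero _
    have hq1 : Function.Periodic.qParam 1 (τ : ℂ) ≠ 0 := Function.Periodic.qParam_ne_zero _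
    have : ∀ S ∈ N.primeFactors.powerset,
        eta (((N / primeProd S : ℕ) : ℂ) * (τ : ℂ)) ^ exponent N S
        = Function.Periodic.qParam 24 (τ : ℂ) ^ (exponent N S * ((N / primeProd S : ℕ) : ℤ)) *
          eulerProduct (Function.Periodic.qParam 1 τ ^ (N / primeProd S)) ^ exponent N S :=
      fun S _ ↦ by
        rw [eta_natCast_mul, mul_zpow, mul_comm (exponent N S), zpow_mul, zpow_natCast]
    rw [g, Finset.prod_congr rfl this, Finset.prod_mul_distrib, prod_zpow_eq_zpow_sum hq0, hM,
      zpow_mul, show Function.Periodic.qParam 24 (τ : ℂ) ^ (24 : ℤ)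
        = Function.Periodic.qParam 1 (τ : ℂ) by exact_mod_cast qParam_twentyFour_pow τ, hG,
      mul_right_comm, ← zpow_add₀ hq1]
    simp
  refine ⟨_, hasFourierExpansion_of_hasSum M (taylorSeries G) fun τ ↦ ?_, fun n ↦ ?_⟩
  · have hq : Function.Periodic.qParam 1 (τ : ℂ) ∈ Metric.ball (0 : ℂ) 1 := by
      simpa using Function.Periodic.norm_qParam_lt_one one_pos τ.im_pos
    have hs := hasSum_taylorSeries_on_ball hdiff hq
    rw [← hg] at hs
    simp only [Nat.cast_one]
    refine hs.congr_fun fun m ↦ ?_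
    simp [taylorSeries]; ring
  · rw [HahnSeries.coeff_single_mul, PowerSeries.coeff_coe, hp]
    split_ifs with h
    · exact ⟨0, by simp⟩
    · exact ⟨p.coeff (n - M).natAbs, by simp⟩

end EtaQuotient

theorem proposition2p3 (N : ℕ) (hN : 2 ≤ N) :
    EtaQuotient.IsWeaklyHolomorphicModularFunction (CongruenceSubgroup.Gamma0 N)
        (EtaQuotient.g N) ∧
      EtaQuotient.HasRationalFourierCoefficients (EtaQuotient.g N) :=
  ⟨⟨EtaQuotient.mdifferentiable_g hN, fun _ hγ τ ↦ EtaQuotient.g_smul hN hγ τ,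
    EtaQuotient.exists_hasFourierExpansion_g_smul hN⟩,
    EtaQuotient.hasRationalFourierCoefficients_g hN⟩
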